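/- Let $\Pi$ be a finite set of processes, $F\subseteq\Pi$ the set of Byzantine processes, $C=\Pi\setminus F$ the set of correct processes, and $f\ge |F|$. Each process $i$ has a participant detector $\mathit{PD}_i\subseteq\Pi$, the set of processes that it knows initially; the knowledge connectivity graph $G$ has vertex set $\Pi$ and an edge $(i,j)$ iff $j\in \mathit{PD}_i$, and $G_{\mathrm{safe}}$ is its subgraph induced on $C$. Assume that $G$ satisfies the requirements of the BFT-CUP model: * the undirected graph underlying $G_{\mathrm{safe}}$ is connected; * $G_{\mathrm{safe}}$ has exactly one sink component (a strongly connected component that no path leaves), with vertex set $V_{\mathrm{sink}}$; * the sink component is $(f+1)$-strongly connected, i.e. there are at least $f+1$ node-disjoint paths in it from any of its vertices to any other; * $G_{\mathrm{safe}}$ has at least $f+1$ node-disjoint paths from every $i\in C\setminus V_{\mathrm{sink}}$ to every $j\in V_{\mathrm{sink}}$; * $|V_{\mathrm{sink}}|\ge 2f+1$. The elements of $V_{\mathrm{sink}}$ are the correct sink members. The processes communicate over authenticated point-to-point channels, under partial synchrony: every message between correct processes is eventually delivered, and in each execution there are a time $\mathrm{GST}$ and a $\delta>0$ such that every message sent between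 correct processes at or after $\mathrm{GST}$ is delivered within $\delta$. Byzantine processes behave arbitrarily, but cannot forge the signature of a correct process. Every correct process $i$ executes the Discovery algorithm: * It starts with $\mathcal S_{PD}=\{\langle i,\mathit{PD}_i\rangle_i\}$ (its participant detector, signed by $i$), $\mathcal S_{\mathrm{known}}=\mathit{PD}_i\cup\{i\}$ and $\mathcal S_{\mathrm{received}}=\{i\}$. * Periodically, it sends $\langle\mathrm{GetPDs}\rangle$ to all $j\in \mathcal S_{\mathrm{known}}$. * Upon receiving $\langle\mathrm{GetPDs}\rangle$ from $j$, it sends $\langle\mathrm{SetPDs},\mathcal S_{PD}\rangle$ to $j$. * Upon receiving $\langle\mathrm{SetPDs},\mathit{pds}\rangle$ from $j$, if $\mathit{pds}$ contains a participant detector signed by $j$, it adds $\mathit{pds}$ to $\mathcal S_{PD}$, adds the members of all participant detectors in $\mathit{pds}$ to $\mathcal S_{\mathrm{known}}$, and adds the owners (signers) of all participant detectors in $\mathit{pds}$ to $\mathcal S_{\mathrm{received}}$. Then in every execution, for every correct process $i$ there is a time from which on the local sets of $i$ satisfy: (a) $V_{\mathrm{sink}}\subseteq\mathcal S_{\mathrm{known}}$,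 i.e. $i$ knows all correct sink members; moreover $\mathit{PD}_j\subseteq \mathcal S_{\mathrm{known}}$ for every $j\in V_{\mathrm{sink}}$, so $i$ also knows every Byzantine process that some correct sink member knows initially; (b) $V_{\mathrm{sink}}\subseteq\mathcal S_{\mathrm{received}}$, and $\langle j,\mathit{PD}_j\rangle_j\in\mathcal S_{PD}$ for every $j\in V_{\mathrm{sink}}$, i.e. $i$ has received the signed participant detectors of all correct sink members. -/

import Mathlib

namespace BFTCUP

/-! ### Directed graphs, node-disjoint paths, sink components -/

/-- The subgraph of `G` induced on the vertex set `s`. -/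
def induced {V : Type*} (G : Digraph V) (s : Set V) : Digraph s where
  Adj a b := G.Adj a b

/-- `l` is the vertex list of a (simple) directed path of `G` from `i` to `j`. -/
def IsPath {V : Type*} (G : Digraph V) (i j : V) (l : List V) : Prop :=
  l.IsChain G.Adj ∧ l.Nodup ∧ l.head? = some i ∧ l.getLast? = some j

/-- `G` has (at least) `k` node-disjoint paths from `i` to `j`: `k` different paths,
no two of which share a vertex other than the end points `i` and `j`. -/
def HasDisjointPaths {V : Type*} (G : Digraph V) (k : ℕ) (i j : V) : Prop :=
  ∃ p : Fin k → List V, Function.Injective p ∧ (∀ a, IsPath G i j (p a)) ∧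
    ∀ a b, a ≠ b → ∀ v, v ∈ p a → v ∈ p b → v = i ∨ v = j

/-- `G` is `k`-strongly connected. -/
def IsKStronglyConnected {V : Type*} (G : Digraph V) (k : ℕ) : Prop :=
  ∀ i j : V, i ≠ j → HasDisjointPaths G k i j

/-- There is a (possibly trivial) directed walk from `i` to `j`. -/
def Reaches {V : Type*} (G : Digraph V) (i j : V) : Prop :=
  Relation.ReflTransGen G.Adj i j

/-- `S` is the vertex set of a strongly connected component of `G`. -/
def IsStronglyConnectedComponent {V : Type*} (G : Digraph V) (S : Set V) : Prop :=
  ∃ v, S = {w | Reaches G v w ∧ Reaches G w v}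

/-- `S` is the vertex set of a sink component of `G`: a strongly connected component from which
no path leads to a vertex outside it. -/
def IsSinkComponent {V : Type*} (G : Digraph V) (S : Set V) : Prop :=
  IsStronglyConnectedComponent G S ∧ ∀ v ∈ S, ∀ w, Reaches G v w → w ∈ S

/-- `v` is a sink member of `G`: it belongs to a sink component of `G`. -/
def IsSinkMember {V : Type*} (G : Digraph V) (v : V) : Prop :=
  ∃ S, IsSinkComponent G S ∧ v ∈ S

/-- `G` belongs to `k`-OSR PD (`k`-one sink reducibility). -/
def IsOSR {V : Type*} (G : Digraph V) (k : ℕ) : Prop :=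
  G.toSimpleGraphInclusive.Connected ∧
  ∃ S : Set V, IsSinkComponent G S ∧ (∀ T, IsSinkComponent G T → T = S) ∧
    IsKStronglyConnected (induced G S) k ∧
    ∀ i, i ∉ S → ∀ j, j ∈ S → HasDisjointPaths G k i j

/-- The knowledge connectivity graph: an edge from `i` to `j` iff `j ∈ PD i`. -/
def knowledgeGraph {P : Type*} (PD : P → Set P) : Digraph P where
  Adj i j := j ∈ PD i

/-- The safe subgraph: all Byzantine processes (the set `F`) are removed. -/
def safeGraph {P : Type*} (G : Digraph P) (F : Set P) : Digraph (Fᶜ : Set P) :=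
  induced G Fᶜ

/-- The knowledge connectivity graph `G`, with Byzantine processes `F` and fault threshold `f`,
satisfies the requirements of the BFT-CUP model. -/
def MeetsBFTCUP {P : Type*} (G : Digraph P) (F : Set P) (f : ℕ) : Prop :=
  IsOSR (safeGraph G F) (f + 1) ∧
  ∀ S, IsSinkComponent (safeGraph G F) S → 2 * f + 1 ≤ S.ncard

/-- `i` is a correct sink member: it is correct and belongs to the sink component of the safe
subgraph of `G`. -/
def IsCorrectSinkMember {P : Type*} (G : Digraph P) (F : Set P) (i : P) : Prop :=
  ∃ h : i ∈ Fᶜ, IsSinkMember (safeGraph G F) ⟨i, h⟩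

/-! ### The Discovery algorithm -/

/-- The signed message `⟨owner, pd⟩_owner`: the participant detector `pd` of the process `owner`,
signed by `owner`. -/
structure SignedPD (P : Type*) where
  owner : P
  pd : Set P

/-- The messages of the algorithm.  Anything else that a Byzantine process may send (malformed
messages, invalid signatures) is dropped by its receiver, which amounts to not sending it. -/
inductive Msg (P : Type*) where
  | getPDs : Msg P
  | setPDs (pds : Set (SignedPD P)) : Msg P

/-- The three local sets `S_PD`, `S_known`, `S_received` of a process. -/
structure LocalState (P : Type*) where
  sPD : Set (SignedPD P)
  known : Set P
  received : Set P

/-- The local sets of process `i` when it starts the task. -/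
def initState {P : Type*} (PD : P → Set P) (i : P) : LocalState P where
  sPD := {⟨i, PD i⟩}
  known := PD i ∪ {i}
  received := {i}

/-- The messages sent in one atomic step, at most one per destination. -/
abbrev Outbox (P : Type*) := P → Option (Msg P)

open Classical in
/-- The periodic step: send `GetPDs` to every known process. -/
noncomputable def periodicOut {P : Type*} (s : LocalState P) : Outbox P :=
  fun j => if j ∈ s.known then some Msg.getPDs else none

open Classical in
/-- The update of the local sets upon receiving `SetPDs pds` from `j`; it takes place only if
`pds` contains a participant detector signed by `j`. -/
noncomputable def update {P : Type*} (s : LocalState P) (j : P) (pds : Set (SignedPD P)) :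
    LocalState P :=
  if ∃ X, (⟨j, X⟩ : SignedPD P) ∈ pds then
    { sPD := s.sPD ∪ pds
      known := s.known ∪ {k | ∃ q ∈ pds, k ∈ q.pd}
      received := s.received ∪ {k | ∃ q ∈ pds, q.owner = k} }
  else s

open Classical in
/-- The reaction of a process in local state `s` to a message received from `j`:
its new local state and the messages that it sends. -/
noncomputable def react {P : Type*} (s : LocalState P) (j : P) : Msg P → LocalState P × Outbox P
  | Msg.getPDs => (s, fun k => if k = j then some (Msg.setPDs s.sPD) else none)
  | Msg.setPDs pds => (update s j pds, fun _ => none)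

/-! ### Executions in a partially synchronous system with Byzantine processes -/

/-- An execution of the Discovery algorithm with participant detectors `PD` in which exactly the
processes in `F` are Byzantine.

It is a sequence of atomic steps; step `n` is taken by the process `actor n` at real time `time n`.
If `input n = some m`, then in step `n` this process receives the message sent to it in step `m`
(by `actor m`); if `input n = none`, the step is spontaneous, which for a correct process means
that it is one of its periodic steps.  `out n` are the messages sent in step `n`, and `state n i`
is the local state of `i` just before step `n` (of no significance for Byzantine `i`). -/
structure Execution {P : Type*} (PD : P → Set P) (F : Set P) where
  time : ℕ → ℝ
  actor : ℕ → P
  input : ℕ → Option ℕ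
  out : ℕ → Outbox P
  state : ℕ → P → LocalState P
  time_mono : Monotone time
  time_unbounded : ∀ t : ℝ, ∃ n, t ≤ time n
  /-- A received message was sent before, to the process that receives it. -/
  no_creation : ∀ n m, input n = some m → m < n ∧ (out m (actor n)).isSome
  /-- A message is received at most once. -/
  no_duplication : ∀ n n' m, actor n = actor n' → input n = some m → input n' = some m → n = n'
  /-- Channels between correct processes are reliable. -/
  reliable : ∀ m j, actor m ∉ F → j ∉ F → (out m j).isSome →
    ∃ n, actor n = j ∧ input n = some m
  /-- Partial synchrony: from some time GST on, message delays between correct processes are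
  bounded by some `δ`. -/
  partial_sync : ∃ GST δ : ℝ, 0 < δ ∧ ∀ n m, input n = some m →
    actor m ∉ F → actor n ∉ F → GST ≤ time m → time n ≤ time m + δ
  /-- Correct processes start in the initial state of the algorithm. -/
  init : ∀ i, i ∉ F → state 0 i = initState PD i
  /-- The local state of a correct process changes only in its own steps. -/
  frame : ∀ n i, i ∉ F → actor n ≠ i → state (n + 1) i = state n i
  /-- A spontaneous step of a correct process. -/
  periodic_step : ∀ n, actor n ∉ F → input n = none →
    state (n + 1) (actor n) = state n (actor n) ∧ out n = periodicOut (state n (actor n))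
  /-- A correct process that receives a message reacts as the algorithm says. -/
  receive_step : ∀ n m msg, actor n ∉ F → input n = some m → out m (actor n) = some msg →
    (state (n + 1) (actor n), out n) = react (state n (actor n)) (actor m) msg
  /-- Correct processes take periodic steps again and again (no matter how long the periods). -/
  periodically : ∀ i, i ∉ F → ∀ t : ℝ, ∃ n, t ≤ time n ∧ actor n = i ∧ input n = none
  /-- Byzantine processes send whatever they like, to whomever they like, except that they cannot
  forge signatures: the only participant detector that bears the signature of a correct process
  `i` is `PD i`.  (They may sign anything as any Byzantine process.) -/
  unforgeable : ∀ n j pds, actor n ∈ F → out n j = some (Msg.setPDs pds) →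
    ∀ q ∈ pds, q.owner ∉ F → q.pd = PD q.owner

end BFTCUP

namespace BFTCUP

/-! ### Reachability of the sink component -/

/-! Local sets never shrink, whatever Byzantine processes send, so each piece of knowledge needs to
be acquired only once. If a correct `i` knows a correct `j`, a later periodic request reaches `j`,
and the answer contains `j`'s own signed detector, after which `i` knows all of `PD j`
(`exists_hasPD_of_known`). Knowledge thus spreads along the edges of the safe graph
(`exists_hasPD_of_reaches`), in which every correct process reaches every sink member
(`IsOSR.reaches_of_isSinkMember`). There are finitely many sink members, so one time serves all of
them. -/

theorem reaches_of_isChain {V : Type*} {G : Digraph V} {i j : V} {l : List V}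
    (hc : l.IsChain G.Adj) (hi : l.head? = some i) (hj : l.getLast? = some j) :
    Reaches G i j := by
  induction l generalizing i with
  | nil => simp at hi
  | cons a l ih =>
    obtain rfl : a = i := by simpa using hi
    cases l with
    | nil =>
      obtain rfl : a = j := by simpa using hj
      exact Relation.ReflTransGen.refl
    | cons b l =>
      rw [List.isChain_cons_cons] at hc
      exact Relation.ReflTransGen.head hc.1 (ih hc.2 rfl (by simpa using hj))

theorem HasDisjointPaths.reaches {V : Type*} {G : Digraph V} {k : ℕ} {i j : V}
    (h : HasDisjointPaths G (k + 1) i j) : Reaches G i j := by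
  obtain ⟨p, -, hp, -⟩ := h
  -- The index type `Fin (k + 1)` is nonempty; a single path is enough.
  obtain ⟨hc, -, hi, hj⟩ := hp 0
  exact reaches_of_isChain hc hi hj

theorem IsStronglyConnectedComponent.reaches {V : Type*} {G : Digraph V} {S : Set V}
    (h : IsStronglyConnectedComponent G S) {i j : V} (hi : i ∈ S) (hj : j ∈ S) :
    Reaches G i j := by
  obtain ⟨v, rfl⟩ := h
  exact Relation.ReflTransGen.trans hi.2 hj.1

theorem IsOSR.reaches_of_isSinkMember {V : Type*} {G : Digraph V} {k : ℕ}
    (h : IsOSR G (k + 1)) (i : V) {j : V} (hj : IsSinkMember G j) : Reaches G i j := by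
  obtain ⟨-, S, hS, huniq, -, hpaths⟩ := h
  obtain ⟨T, hT, hjT⟩ := hj
  obtain rfl := huniq T hT
  by_cases hi : i ∈ T
  · exact hS.1.reaches hi hjT
  · exact (hpaths i hi j hjT).reaches

/-! ### Growth of the local sets -/

/-- Componentwise inclusion of local states. -/
def LocalState.Sub {P : Type*} (s t : LocalState P) : Prop :=
  s.sPD ⊆ t.sPD ∧ s.known ⊆ t.known ∧ s.received ⊆ t.received

/-- The local state `s` contains the signed participant detector of `j` and everything that
a process learns from it. -/
def LocalState.HasPD {P : Type*} (PD : P → Set P) (s : LocalState P) (j : P) : Prop :=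
  j ∈ s.known ∧ PD j ⊆ s.known ∧ j ∈ s.received ∧ (⟨j, PD j⟩ : SignedPD P) ∈ s.sPD

theorem LocalState.Sub.refl {P : Type*} (s : LocalState P) : s.Sub s :=
  ⟨subset_rfl, subset_rfl, subset_rfl⟩

theorem LocalState.Sub.trans {P : Type*} {s t u : LocalState P} (h : s.Sub t) (h' : t.Sub u) :
    s.Sub u :=
  ⟨h.1.trans h'.1, h.2.1.trans h'.2.1, h.2.2.trans h'.2.2⟩

theorem LocalState.HasPD.mono {P : Type*} {PD : P → Set P} {s t : LocalState P} {j : P}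
    (h : s.HasPD PD j) (hst : s.Sub t) : t.HasPD PD j :=
  ⟨hst.2.1 h.1, h.2.1.trans hst.2.1, hst.2.2 h.2.2.1, hst.1 h.2.2.2⟩

theorem sub_update {P : Type*} (s : LocalState P) (j : P) (pds : Set (SignedPD P)) :
    s.Sub (update s j pds) := by
  unfold update
  split_ifs
  · exact ⟨Set.subset_union_left, Set.subset_union_left, Set.subset_union_left⟩
  · exact LocalState.Sub.refl s

theorem sub_react {P : Type*} (s : LocalState P) (j : P) (msg : Msg P) :
    s.Sub (react s j msg).1 := by
  cases msg with
  | getPDs => exact LocalState.Sub.refl s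
  | setPDs pds => exact sub_update s j pds

theorem hasPD_initState {P : Type*} (PD : P → Set P) (i : P) :
    (initState PD i).HasPD PD i := by
  simp [LocalState.HasPD, initState]

/-- `hk` is needed because an update adds owners only to `received`; `j` itself need not belong to
`PD j`. -/
theorem hasPD_update {P : Type*} {PD : P → Set P} {s : LocalState P} {j : P}
    {pds : Set (SignedPD P)} (hk : j ∈ s.known) (h : ⟨j, PD j⟩ ∈ pds) :
    (update s j pds).HasPD PD j := by
  rw [update, if_pos ⟨_, h⟩]
  exact ⟨Or.inl hk, fun k hk => Or.inr ⟨_, h, hk⟩, Or.inr ⟨_, h, rfl⟩, Or.inr h⟩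

/-! ### Spread of knowledge in an execution -/

namespace Execution

variable {P : Type*} {PD : P → Set P} {F : Set P} (E : Execution PD F)

theorem state_of_receive {n m : ℕ} {msg : Msg P} (ha : E.actor n ∉ F) (hin : E.input n = some m)
    (hmsg : E.out m (E.actor n) = some msg) :
    E.state (n + 1) (E.actor n) = (react (E.state n (E.actor n)) (E.actor m) msg).1 :=
  congrArg Prod.fst (E.receive_step n m msg ha hin hmsg)

theorem out_of_receive {n m : ℕ} {msg : Msg P} (ha : E.actor n ∉ F) (hin : E.input n = some m)
    (hmsg : E.out m (E.actor n) = some msg) :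
    E.out n = (react (E.state n (E.actor n)) (E.actor m) msg).2 :=
  congrArg Prod.snd (E.receive_step n m msg ha hin hmsg)

theorem state_sub_succ {i : P} (hi : i ∉ F) (n : ℕ) :
    (E.state n i).Sub (E.state (n + 1) i) := by
  by_cases ha : E.actor n = i
  · subst ha
    rcases hin : E.input n with _ | m
    · rw [(E.periodic_step n hi hin).1]
      exact LocalState.Sub.refl _
    · obtain ⟨msg, hmsg⟩ := Option.isSome_iff_exists.mp (E.no_creation n m hin).2
      rw [E.state_of_receive hi hin hmsg]
      exact sub_react _ _ _
  · rw [E.frame n i hi ha]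
    exact LocalState.Sub.refl _

theorem state_sub {i : P} (hi : i ∉ F) {n m : ℕ} (h : n ≤ m) :
    (E.state n i).Sub (E.state m i) := by
  induction m, h using Nat.le_induction with
  | base => exact LocalState.Sub.refl _
  | succ m _ ih => exact ih.trans (E.state_sub_succ hi m)

theorem hasPD_self {i : P} (hi : i ∉ F) (n : ℕ) : (E.state n i).HasPD PD i := by
  have h := hasPD_initState PD i
  rw [← E.init i hi] at h
  exact h.mono (E.state_sub hi n.zero_le)

/-- Step numbers from some point on occur at times from some point on. -/
theorem exists_time_le_imp_le (N : ℕ) : ∃ T : ℝ, ∀ n, T ≤ E.time n → N ≤ n := by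
  -- The `+ 1` is there because steps before `N` may occur at the same time as step `N`.
  refine ⟨E.time N + 1, fun n hn => ?_⟩
  by_contra! h
  linarith [E.time_mono h.le]

theorem exists_periodic_step_ge {i : P} (hi : i ∉ F) (N : ℕ) :
    ∃ n, N ≤ n ∧ E.actor n = i ∧ E.input n = none := by
  obtain ⟨T, hT⟩ := E.exists_time_le_imp_le N
  obtain ⟨n, hn, ha, hin⟩ := E.periodically i hi T
  exact ⟨n, hT n hn, ha, hin⟩

/-- A request to a known correct process is eventually answered with its participant detector. -/
theorem exists_hasPD_of_known {i j : P} (hi : i ∉ F) (hj : j ∉ F) {N : ℕ}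
    (hk : j ∈ (E.state N i).known) : ∃ n, (E.state n i).HasPD PD j := by
  obtain ⟨n, hNn, rfl, hin⟩ := E.exists_periodic_step_ge hi N
  have hkn := (E.state_sub hi hNn).2.1 hk
  have hreq : E.out n j = some Msg.getPDs := by
    rw [(E.periodic_step n hi hin).2, periodicOut, if_pos hkn]
  obtain ⟨m, rfl, hm⟩ := E.reliable n j hi hj (by simp [hreq])
  have hans : E.out m (E.actor n) = some (Msg.setPDs (E.state m (E.actor m)).sPD) := by
    rw [E.out_of_receive hj hm hreq]
    simp [react]
  obtain ⟨r, hr, hrm⟩ := E.reliable m (E.actor n) hj hi (by simp [hans])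
  -- Request sent at `n`, answered at `m`, answer received at `r`: by causality `n < m < r`, so `j`
  -- is still known at `r`.
  have hnr : n ≤ r := ((E.no_creation m n hm).1.trans (E.no_creation r m hrm).1).le
  rw [← hr] at hans hi hkn ⊢
  refine ⟨r + 1, ?_⟩
  rw [E.state_of_receive hi hrm hans]
  exact hasPD_update ((E.state_sub hi hnr).2.1 hkn) (E.hasPD_self hj m).2.2.2

/-- Induction along the walk: an edge from `b` to `c` means `c ∈ PD b`, so having the detector of
`b` makes `c` known. All vertices of the walk are correct, so each one answers. -/
theorem exists_hasPD_of_reaches {i j : (Fᶜ : Set P)}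
    (h : Reaches (safeGraph (knowledgeGraph PD) F) i j) :
    ∃ n, (E.state n (i : P)).HasPD PD j := by
  induction h with
  | refl => exact ⟨0, E.hasPD_self i.2 0⟩
  | @tail b c _ hbc ih =>
    obtain ⟨N, hN⟩ := ih
    exact E.exists_hasPD_of_known i.2 c.2 (hN.2.1 hbc)

end Execution

end BFTCUP

theorem mainTheorem11 {P : Type*} [Finite P] (PD : P → Set P) (F : Set P) (f : ℕ)
    (hF : F.ncard ≤ f)
    (hG : BFTCUP.MeetsBFTCUP (BFTCUP.knowledgeGraph PD) F f)
    (E : BFTCUP.Execution PD F) (i : P) (hi : i ∉ F) :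
    ∃ T : ℝ, ∀ n, T ≤ E.time n →
      ∀ j, BFTCUP.IsCorrectSinkMember (BFTCUP.knowledgeGraph PD) F j →
        j ∈ (E.state n i).known ∧
        (∀ k ∈ PD j, k ∈ (E.state n i).known) ∧
        j ∈ (E.state n i).received ∧
        (⟨j, PD j⟩ : BFTCUP.SignedPD P) ∈ (E.state n i).sPD := by
  have hev : ∀ᶠ n in Filter.atTop,
      ∀ j, BFTCUP.IsCorrectSinkMember (BFTCUP.knowledgeGraph PD) F j →
        (E.state n i).HasPD PD j := by
    -- Finiteness of `P` lets the thresholds for the individual `j` be merged into one.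
    refine Filter.eventually_all.mpr fun j => ?_
    by_cases hj : BFTCUP.IsCorrectSinkMember (BFTCUP.knowledgeGraph PD) F j
    · obtain ⟨hjF, hsink⟩ := hj
      obtain ⟨N, hN⟩ :=
        E.exists_hasPD_of_reaches (hG.1.reaches_of_isSinkMember ⟨i, hi⟩ hsink)
      filter_upwards [Filter.eventually_ge_atTop N] with n hn _
      exact hN.mono (E.state_sub hi hn)
    · exact Filter.Eventually.of_forall fun _ h => absurd h hj
  obtain ⟨N, hN⟩ := Filter.eventually_atTop.mp hev
  obtain ⟨T, hT⟩ := E.exists_time_le_imp_le N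
  exact ⟨T, fun n hn => hN n (hT n hn)⟩
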